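/- All graphs are finite and simple. For a graph $G$ with $n$ vertices and adjacency matrix $A(G)$, let $W(G)=[e,A(G)e,\ldots,A(G)^{n-1}e]$ be its walk matrix, where $e$ is the all-ones vector; $\det W(G)$ is determined up to sign independently of the numbering of the vertices. Let $\mathcal F_n$ be the collection of all $n$-vertex graphs $G$ with $\det A(G)=\pm1$ and $\det W(G)=\pm2^{\lfloor n/2\rfloor}$, and let $\mathcal F=\bigcup_{n\text{ even}}\mathcal F_n$. Let $P_m$ be the path with $m$ vertices, labeled naturally $1,2,\ldots,m$. For integers $1\le\ell\le m$ and an $n$-vertex graph $G$, let $G\circ P_m^{(\ell)}$ be the rooted product of $G$ and $P_m$ with root $\ell$, that is, the graph with $mn$ vertices obtained from $G$ and $n$ copies of $P_m$ by identifying, for each $i=1,\ldots,n$, the $i$-th vertex of $G$ with the $\ell$-th vertex of the $i$-th copy of $P_m$. **Proposition.** Let $G\in\mathcal F$. Then $G\circ P_m^{(\ell)}\in\mathcal F$ for any two integers $m$ and $\ell$ with $1\le\ell\le m$ and $\gcd(\ell,m+1)=1$. -/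

import Mathlib

/-- The walk matrix `W(G) = [e, Ae, …, A^(n-1) e]` of a finite graph `G` with `n` vertices, where `A`
is the adjacency matrix and `e` the all-ones vector. Rows are indexed by the vertices of `G`, the
columns by `0, …, n - 1`; the column with index `k` is `A ^ k e`. -/
def walkMatrix {V : Type*} [Fintype V] [DecidableEq V] (G : SimpleGraph V) [DecidableRel G.Adj] :
    Matrix V (Fin (Fintype.card V)) ℤ :=
  Matrix.of fun v k => ((G.adjMatrix ℤ) ^ (k : ℕ)).mulVec (fun _ => 1) v

/-- The rooted product `G ∘ H^(r)`: one copy of `H` for every vertex `i` of `G`, the root `r` of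
the copy with index `i` being identified with `i`. The vertex `a` of the copy with index `i` is the
pair `(i, a)`, and the pair `(i, r)` is also the vertex `i` of `G`. -/
def rootedProduct {V U : Type*} (G : SimpleGraph V) (H : SimpleGraph U) (r : U) :
    SimpleGraph (V × U) where
  Adj x y := (x.1 = y.1 ∧ H.Adj x.2 y.2) ∨ (G.Adj x.1 y.1 ∧ x.2 = r ∧ y.2 = r)
  symm := ⟨by
    rintro x y (⟨h, h'⟩ | ⟨h, hx, hy⟩)
    · exact Or.inl ⟨h.symm, h'.symm⟩
    · exact Or.inr ⟨h.symm, hy, hx⟩⟩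
  loopless := ⟨by
    rintro x (⟨-, h⟩ | ⟨h, -, -⟩)
    · exact H.irrefl h
    · exact G.irrefl h⟩

instance rootedProductDecidableRel {V U : Type*} [DecidableEq V] [DecidableEq U] (G : SimpleGraph V) (H : SimpleGraph U)
    (r : U) [DecidableRel G.Adj] [DecidableRel H.Adj] : DecidableRel (rootedProduct G H r).Adj :=
  fun x y => inferInstanceAs
    (Decidable ((x.1 = y.1 ∧ H.Adj x.2 y.2) ∨ (G.Adj x.1 y.1 ∧ x.2 = r ∧ y.2 = r)))

instance pathGraphDecidableRel (m : ℕ) : DecidableRel (SimpleGraph.pathGraph m).Adj :=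
  fun _ _ => decidable_of_iff' _ SimpleGraph.pathGraph_adj

/-- `G ∘ P_m^(ℓ)`: the rooted product of `G` and the path `P_m` on the vertices `1, …, m`, rooted at
its `ℓ`-th vertex, which is the element `ℓ - 1` of `Fin m`. -/
abbrev rootedProductPath {V : Type*} (G : SimpleGraph V) (m ℓ : ℕ) (h₁ : 1 ≤ ℓ) (h₂ : ℓ ≤ m) :
    SimpleGraph (V × Fin m) :=
  rootedProduct G (SimpleGraph.pathGraph m) ⟨ℓ - 1, by omega⟩

/-- `G` belongs to `𝓕_n`: it has `n` vertices, `det A(G) = ±1` and `det W(G) = ±2^⌊n/2⌋`.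
As a square matrix, `W(G)` depends on a numbering `σ` of the vertices; another numbering permutes
the rows, so that the determinant is defined up to sign, and the condition is the same for all
numberings. -/
def MemFamilyOfOrder {V : Type*} [Fintype V] [DecidableEq V] (n : ℕ) (G : SimpleGraph V)
    [DecidableRel G.Adj] : Prop :=
  Fintype.card V = n ∧
    ((G.adjMatrix ℤ).det = 1 ∨ (G.adjMatrix ℤ).det = -1) ∧
    ∀ σ : Fin (Fintype.card V) ≃ V,
      ((walkMatrix G).submatrix σ id).det = 2 ^ (n / 2) ∨
        ((walkMatrix G).submatrix σ id).det = -2 ^ (n / 2)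

/-- `G` belongs to `𝓕`, the union of the `𝓕_n` over all even `n`. -/
def MemFamily {V : Type*} [Fintype V] [DecidableEq V] (G : SimpleGraph V) [DecidableRel G.Adj] :
    Prop :=
  ∃ n : ℕ, Even n ∧ MemFamilyOfOrder n G

/-!
Let `p = ℓ` and `q = m + 1 - ℓ`, which are coprime, let `A` be the adjacency matrix of `G`, and let
`x` be the adjacency operator `1 ⊗ A(P_m) + A ⊗ E` of the rooted product, acting on `ℤ^(V × Fin m)`.
Write `T = A ⊗ 1`, which commutes with `x`, and `s n` for the Vieta–Fibonacci (rescaled Chebyshev)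
polynomials `s (n + 2) = x * s (n + 1) - s n`. Walking along the path from its two ends to the root
shows that the vertices of a copy of `P_m` are `s i` and `s j` times the end points, and that
`s (p + q) = T * s p * s q` (`vietaFib_add_smul`).

Since `p` and `q` are coprime, `s (p + q)` and `s p * s q` generate the unit ideal of `ℤ[x]`, so the
relation makes `s p * s q` invertible; by Nakayama's lemma its inverse is a polynomial in `x`, hence
so is `T` (`apply_mem_of_mem`). If moreover `det A = ± 1`, then `T`, and with it `s (p + q)`, is
invertible. The all-ones vector on a path is `rootedSum x p q • g`, where `g` generates both end
points, and `rootedSum x p q` divides `s p * s q * s (p + q)` (`rootedSum_dvd`; a product formula for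
sines of half angles), so it is invertible too. It follows that the all-ones vector of the rooted
product generates, over `ℤ[x]`, every vector `A ^ i e ⊗ f_k` (`exists_aeval_mulVec_eq`), where `e` is
the all-ones vector of `G` and `f_k` is the indicator of the `k`-th vertex of the path.

Hence the columns of `W(G ∘ P_m)` and of `W(G) ⊗ 1` span the same subgroup, and
`det W(G ∘ P_m) = ± det W(G) ^ m` (`associated_det_walkMatrix_rootedProduct`). Reducing the relation
`s (p + q) = T * s p * s q` modulo `x` shows that `x` is invertible as well
(`isUnit_det_rootedPathMatrix`).
-/

/-! ### Vieta–Fibonacci numbers -/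

/-- The Vieta–Fibonacci numbers `s 0 = 0`, `s 1 = 1`, `s (n + 2) = x * s (n + 1) - s n` of an element
`x` of a commutative ring; `s (n + 1)` is the characteristic polynomial of the path with `n`
vertices, evaluated at `x`. -/
def vietaFib {R : Type*} [CommRing R] (x : R) : ℕ → R
  | 0 => 0
  | 1 => 1
  | n + 2 => x * vietaFib x (n + 1) - vietaFib x n

section VietaFib

variable {R : Type*} [CommRing R] (x : R)

@[simp] theorem vietaFib_zero : vietaFib x 0 = 0 := rfl

@[simp] theorem vietaFib_one : vietaFib x 1 = 1 := rfl

theorem vietaFib_add_two (n : ℕ) :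
    vietaFib x (n + 2) = x * vietaFib x (n + 1) - vietaFib x n := rfl

theorem vietaFib_add_add_one (a b : ℕ) :
    vietaFib x (a + b + 1) =
      vietaFib x (a + 1) * vietaFib x (b + 1) - vietaFib x a * vietaFib x b := by
  induction a using Nat.twoStepInduction with
  | zero => simp
  | one => rw [show 1 + b + 1 = b + 2 by ring, vietaFib_add_two, vietaFib_add_two]; simp
  | more a ih₁ ih₂ =>
    rw [show a + 2 + b + 1 = (a + b + 1) + 2 by ring, vietaFib_add_two,
      show a + b + 1 + 1 = a + 1 + b + 1 by ring, ih₁, ih₂, vietaFib_add_two x (a + 1),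
      vietaFib_add_two x a]
    ring

theorem vietaFib_two_mul (a : ℕ) :
    vietaFib x (2 * a) = vietaFib x a * (2 * vietaFib x (a + 1) - x * vietaFib x a) := by
  cases a with
  | zero => simp
  | succ a =>
    rw [show 2 * (a + 1) = (a + 1) + a + 1 by ring, vietaFib_add_add_one, vietaFib_add_two]
    ring

theorem vietaFib_two_mul_add_one (a : ℕ) :
    vietaFib x (2 * a + 1) =
      (vietaFib x a + vietaFib x (a + 1)) * (vietaFib x (a + 1) - vietaFib x a) := by
  rw [two_mul, vietaFib_add_add_one]
  ring

theorem vietaFib_add (a b : ℕ) :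
    vietaFib x (a + b) = vietaFib x a * vietaFib x (b + 1)
      + (vietaFib x (a + 1) - x * vietaFib x a) * vietaFib x b := by
  cases a with
  | zero => simp
  | succ a =>
    rw [show a + 1 + b = a + b + 1 by ring, vietaFib_add_add_one, vietaFib_add_two]
    ring

theorem sum_vietaFib_two_mul (a : ℕ) :
    ∑ j ∈ Finset.range (2 * a + 1), vietaFib x j =
      vietaFib x a * (vietaFib x a + vietaFib x (a + 1)) := by
  induction a with
  | zero => simp
  | succ a ih =>
    rw [show 2 * (a + 1) + 1 = 2 * a + 1 + 1 + 1 by ring, Finset.sum_range_succ,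
      Finset.sum_range_succ, ih, vietaFib_two_mul_add_one, show 2 * a + 1 + 1 = 2 * (a + 1) by ring,
      vietaFib_two_mul, vietaFib_add_two]
    ring

theorem sum_vietaFib_two_mul_add_one (a : ℕ) :
    ∑ j ∈ Finset.range (2 * a + 2), vietaFib x j =
      vietaFib x (a + 1) * (vietaFib x a + vietaFib x (a + 1)) := by
  rw [Finset.sum_range_succ, sum_vietaFib_two_mul, vietaFib_two_mul_add_one]
  ring

theorem isCoprime_vietaFib_succ (n : ℕ) : IsCoprime (vietaFib x (n + 1)) (vietaFib x n) := by
  induction n with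
  | zero => simpa using isCoprime_one_left
  | succ n ih =>
    obtain ⟨a, b, h⟩ := ih
    exact ⟨-b, a + b * x, by rw [vietaFib_add_two]; linear_combination h⟩

/-- The Euclidean algorithm on the indices. -/
theorem isCoprime_vietaFib {p q : ℕ} (h : Nat.Coprime p q) :
    IsCoprime (vietaFib x p) (vietaFib x q) := by
  induction hN : p + q using Nat.strong_induction_on generalizing p q with
  | _ N ih =>
    wlog hpq : p ≤ q generalizing p q
    · exact (this h.symm (by omega) (by omega)).symm
    obtain ⟨r, rfl⟩ := Nat.exists_eq_add_of_le' hpq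
    cases p with
    | zero =>
      have : r = 1 := by simpa using h
      simpa [this] using isCoprime_one_right
    | succ p =>
      have hr : Nat.Coprime (p + 1) r := by simpa using h
      have h₁ := ih (p + 1 + r) (by omega) hr rfl
      have h₂ := h₁.mul_right (isCoprime_vietaFib_succ x p)
      rw [← add_assoc, vietaFib_add_add_one]
      have := h₂.neg_right.add_mul_left_right (vietaFib x (r + 1))
      convert this using 1
      ring

theorem isCoprime_vietaFib_add_mul {p q : ℕ} (h : Nat.Coprime p q) :
    IsCoprime (vietaFib x (p + q)) (vietaFib x p * vietaFib x q) :=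
  (isCoprime_vietaFib x (by simpa using h.symm)).mul_right
    (isCoprime_vietaFib x (by simpa using h))

theorem dvd_vietaFib_of_even {n : ℕ} (h : Even n) : x ∣ vietaFib x n := by
  obtain ⟨k, rfl⟩ := h
  induction k with
  | zero => simp
  | succ k ih =>
    rw [show k + 1 + (k + 1) = k + k + 2 by ring, vietaFib_add_two]
    exact (Dvd.intro _ rfl).sub ih

theorem isCoprime_vietaFib_of_odd {n : ℕ} (h : Odd n) : IsCoprime x (vietaFib x n) := by
  obtain ⟨k, rfl⟩ := h
  exact ((isCoprime_vietaFib_succ x (2 * k)).of_isCoprime_of_dvd_right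
    (dvd_vietaFib_of_even x (even_two_mul k))).symm

/-- The sum of the entries of the vector
`(s q * s 1, …, s q * s p = s p * s q, s p * s (q - 1), …, s p * s 1)`. With `x = 2 cos θ` it is
`sin (p θ / 2) * sin (q θ / 2) * sin ((p + q) θ / 2)` up to a factor independent of `p` and `q`. -/
def rootedSum (p q : ℕ) : R :=
  vietaFib x q * ∑ j ∈ Finset.range (p + 1), vietaFib x j +
    vietaFib x p * ∑ j ∈ Finset.range q, vietaFib x j

theorem rootedSum_comm (p q : ℕ) : rootedSum x p q = rootedSum x q p := by
  simp only [rootedSum, Finset.sum_range_succ]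
  ring

theorem rootedSum_odd_odd (a b : ℕ) :
    rootedSum x (2 * a + 1) (2 * b + 1) = (vietaFib x a + vietaFib x (a + 1)) *
      (vietaFib x b + vietaFib x (b + 1)) * vietaFib x (a + b + 1) := by
  rw [rootedSum, vietaFib_two_mul_add_one, vietaFib_two_mul_add_one, sum_vietaFib_two_mul_add_one,
    sum_vietaFib_two_mul, vietaFib_add_add_one]
  ring

theorem rootedSum_even_odd (a b : ℕ) :
    rootedSum x (2 * a) (2 * b + 1) = vietaFib x a *
      (vietaFib x b + vietaFib x (b + 1)) * (vietaFib x (a + b) + vietaFib x (a + b + 1)) := by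
  rw [rootedSum, vietaFib_two_mul_add_one, vietaFib_two_mul, sum_vietaFib_two_mul,
    sum_vietaFib_two_mul, vietaFib_add_add_one x a b, vietaFib_add x a b]
  ring

/-- Each of the three sines of half angles divides the sine of the full angle. -/
theorem rootedSum_dvd {p q : ℕ} (h : Nat.Coprime p q) :
    rootedSum x p q ∣ vietaFib x p * vietaFib x q * vietaFib x (p + q) := by
  have hodd (a : ℕ) : vietaFib x a + vietaFib x (a + 1) ∣ vietaFib x (2 * a + 1) :=
    ⟨_, vietaFib_two_mul_add_one x a⟩
  have heven (a : ℕ) : vietaFib x a ∣ vietaFib x (2 * a) := ⟨_, vietaFib_two_mul x a⟩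
  have key (a b : ℕ) : rootedSum x (2 * a) (2 * b + 1) ∣
      vietaFib x (2 * a) * vietaFib x (2 * b + 1) * vietaFib x (2 * a + (2 * b + 1)) := by
    rw [rootedSum_even_odd, show 2 * a + (2 * b + 1) = 2 * (a + b) + 1 by ring]
    exact mul_dvd_mul (mul_dvd_mul (heven a) (hodd b)) (hodd _)
  rcases Nat.even_or_odd' p with ⟨a, rfl | rfl⟩ <;> rcases Nat.even_or_odd' q with ⟨b, rfl | rfl⟩
  · exact absurd (Nat.dvd_gcd (Dvd.intro a rfl) (Dvd.intro b rfl)) (by rw [h]; decide)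
  · exact key a b
  · rw [rootedSum_comm, mul_comm (vietaFib x _) (vietaFib x _), add_comm (2 * a + 1)]
    exact key b a
  · rw [rootedSum_odd_odd, show 2 * a + 1 + (2 * b + 1) = 2 * (a + b + 1) by ring]
    exact mul_dvd_mul (mul_dvd_mul (hodd a) (hodd b)) (heven _)

end VietaFib

/-! ### Two chains meeting at a root -/

section RootedPair

variable {R M : Type*} [CommRing R] [AddCommGroup M] [Module R M]

/-- The end points `a` and `b` of a path with `p + q - 1` vertices on which `x` acts as the adjacency
operator of the path plus a loop of weight `T` at the `p`-th vertex. The vertex with number `i`,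
counted from the end `a`, is `s i • a` up to the root, and the one with number `j`, counted from the
end `b`, is `s j • b` up to the root: the two expressions for the root agree, and
`x • root = left neighbour + right neighbour + T root`. -/
structure IsRootedPair (x : R) (T : Module.End R M) (p q : ℕ) (a b : M) : Prop where
  root_eq : vietaFib x p • a = vietaFib x q • b
  smul_root : x • vietaFib x p • a =
    vietaFib x (p - 1) • a + vietaFib x (q - 1) • b + T (vietaFib x p • a)

variable {x : R} {T : Module.End R M} {p q : ℕ} {a b : M}

theorem IsRootedPair.symm (h : IsRootedPair x T p q a b) : IsRootedPair x T q p b a :=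
  ⟨h.root_eq.symm, by rw [← h.root_eq, h.smul_root]; abel⟩

theorem IsRootedPair.smul_left (h : IsRootedPair x T p q a b) (hp : 0 < p) (hq : 0 < q) :
    vietaFib x (p + q) • a = T ((vietaFib x p * vietaFib x q) • a) := by
  obtain ⟨p, rfl⟩ := Nat.exists_eq_add_one.mpr hp
  obtain ⟨q, rfl⟩ := Nat.exists_eq_add_one.mpr hq
  have h₁ := h.root_eq
  have h₂ := h.smul_root
  simp only [Nat.add_sub_cancel] at h₂
  rw [mul_comm, mul_smul, map_smul, ← add_assoc, vietaFib_add_add_one, vietaFib_add_two,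
    eq_sub_of_add_eq' h₂.symm]
  have h₃ := congrArg (vietaFib x q • ·) h₁
  linear_combination (norm := module) -h₃

/-- A form of Nakayama's lemma: the inverse of an element acting surjectively is again given by an
element of the ring. -/
theorem exists_mul_smul_eq_self [Module.Finite R M] {r : R}
    (h : Function.Surjective (r • · : M → M)) : ∃ r' : R, ∀ w : M, (r' * r) • w = w := by
  obtain ⟨c, hc, hcM⟩ := Submodule.exists_sub_one_mem_and_smul_eq_zero_of_fg_of_le_smul
    (Ideal.span {r}) (⊤ : Submodule R M) Module.Finite.fg_top (by
      intro w _
      obtain ⟨w', rfl⟩ := h w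
      exact Submodule.smul_mem_smul (Ideal.mem_span_singleton_self r) trivial)
  obtain ⟨d, hd⟩ := Ideal.mem_span_singleton'.mp hc
  refine ⟨-d, fun w => ?_⟩
  have := hcM w trivial
  rw [show -d * r = 1 - c by linear_combination -hd, sub_smul, this, one_smul, sub_zero]

/-- By Cayley–Hamilton for the path with a loop, the characteristic polynomial
`s (p + q) - T * s p * s q` vanishes on a module spanned by the end points of such paths. -/
theorem vietaFib_add_smul (hp : 0 < p) (hq : 0 < q)
    (hspan : Submodule.span R {c : M | ∃ d, IsRootedPair x T p q c d ∨ IsRootedPair x T p q d c} = ⊤)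
    (w : M) : vietaFib x (p + q) • w = T ((vietaFib x p * vietaFib x q) • w) := by
  have hw : w ∈ Submodule.span R
    {c : M | ∃ d, IsRootedPair x T p q c d ∨ IsRootedPair x T p q d c} := hspan ▸ trivial
  induction hw using Submodule.span_induction with
  | mem a h =>
    obtain ⟨b, h | h⟩ := h
    · exact h.smul_left hp hq
    · rw [add_comm, mul_comm]
      exact h.symm.smul_left hq hp
  | zero => simp
  | add v w _ _ hv hw => simp only [smul_add, map_add, hv, hw]
  | smul c w _ hw => rw [smul_comm, hw, ← map_smul, smul_comm]

/-- Along a path starting at `f 1`, the vertices are determined by the first one. -/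
theorem eq_vietaFib_smul {f : ℕ → M} {n : ℕ} (h₀ : f 0 = 0)
    (hf : ∀ j, j + 2 ≤ n → x • f (j + 1) = f j + f (j + 2)) (j : ℕ) (hj : j ≤ n) :
    f j = vietaFib x j • f 1 := by
  induction j using Nat.twoStepInduction with
  | zero => simp [h₀]
  | one => simp
  | more j ih₁ ih₂ =>
    rw [← sub_eq_of_eq_add' (hf j hj), ih₁ (by omega), ih₂ (by omega), vietaFib_add_two]
    module

section Spanned

variable (hpq : Nat.Coprime p q)
  (hT : ∀ w : M, vietaFib x (p + q) • w = T ((vietaFib x p * vietaFib x q) • w))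

include hpq hT

/-- As `s (p + q)` and `s p * s q` generate the unit ideal, and the former is a multiple of the
latter by `hT`, the latter is invertible on `M`. -/
theorem surjective_vietaFib_mul_smul :
    Function.Surjective ((vietaFib x p * vietaFib x q) • · : M → M) := by
  intro w
  obtain ⟨c, d, h⟩ := isCoprime_vietaFib_add_mul x hpq
  refine ⟨c • T w + d • w, ?_⟩
  calc _ = (c * vietaFib x (p + q) + d * (vietaFib x p * vietaFib x q)) • w := by
        rw [add_smul, mul_smul c, hT, map_smul]; module
    _ = w := by rw [h, one_smul]

theorem surjective_vietaFib_add_smul (hTs : Function.Surjective T) :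
    Function.Surjective (vietaFib x (p + q) • · : M → M) := by
  have := hTs.comp (surjective_vietaFib_mul_smul hpq hT)
  convert this using 2 with w
  exact hT w

theorem surjective_rootedSum_smul (hTs : Function.Surjective T) :
    Function.Surjective (rootedSum x p q • · : M → M) := by
  obtain ⟨c, hc⟩ := rootedSum_dvd x hpq
  intro w
  obtain ⟨v, rfl⟩ := surjective_vietaFib_add_smul hpq hT hTs w
  obtain ⟨u, rfl⟩ := surjective_vietaFib_mul_smul hpq hT v
  refine ⟨c • u, ?_⟩
  simp only [smul_smul]
  rw [← hc, mul_comm]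

/-- `T` acts as an element of `R`. -/
theorem apply_mem_of_mem [Module.Finite R M] {L : Submodule R M} {w : M} (hw : w ∈ L) :
    T w ∈ L := by
  obtain ⟨r, hr⟩ := exists_mul_smul_eq_self (surjective_vietaFib_mul_smul hpq hT)
  have : T w = (r * vietaFib x (p + q)) • w := by
    conv_lhs => rw [← hr w, mul_smul, map_smul, ← hT, smul_smul]
  exact this ▸ L.smul_mem _ hw

/-- The sum of the vertices of the path generates its end points: the common source
`g` of the end points `a = s q • g` and `b = s p • g` satisfies `sum = rootedSum • g`. -/
theorem IsRootedPair.mem_of_sum_mem [Module.Finite R M] (hTs : Function.Surjective T)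
    (h : IsRootedPair x T p q a b) {L : Submodule R M}
    (hL : (∑ j ∈ Finset.range (p + 1), vietaFib x j) • a +
      (∑ j ∈ Finset.range q, vietaFib x j) • b ∈ L) : a ∈ L ∧ b ∈ L := by
  obtain ⟨c, d, hcd⟩ := isCoprime_vietaFib x hpq
  obtain ⟨r, hr⟩ := exists_mul_smul_eq_self (surjective_rootedSum_smul hpq hT hTs)
  set g := d • a + c • b with hg
  have ha : a = vietaFib x q • g := by
    calc a = (c * vietaFib x p + d * vietaFib x q) • a := by rw [hcd, one_smul]
      _ = c • vietaFib x p • a + (d * vietaFib x q) • a := by module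
      _ = _ := by rw [h.root_eq, hg]; module
  have hb : b = vietaFib x p • g := by
    calc b = (c * vietaFib x p + d * vietaFib x q) • b := by rw [hcd, one_smul]
      _ = (c * vietaFib x p) • b + d • vietaFib x q • b := by module
      _ = _ := by rw [← h.root_eq, hg]; module
  have hgL : g ∈ L := by
    rw [← hr g]
    have := L.smul_mem r hL
    rw [ha, hb] at this
    convert this using 1
    rw [rootedSum]
    module
  exact ⟨ha ▸ L.smul_mem _ hgL, hb ▸ L.smul_mem _ hgL⟩

/-- Modulo `x`, the relation `s (p + q) = T * s p * s q` reads `± 1 = 0` if one of `p` and `q` is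
even, and `0 = ± T` otherwise. -/
theorem surjective_smul_self (hTs : Function.Surjective T) :
    Function.Surjective (x • · : M → M) := by
  have hcases : (Odd (p + q) ∧ x ∣ vietaFib x p * vietaFib x q) ∨
      (Even (p + q) ∧ IsCoprime x (vietaFib x p * vietaFib x q)) := by
    rcases Nat.even_or_odd p with h₁ | h₁ <;> rcases Nat.even_or_odd q with h₂ | h₂
    · exact absurd (Nat.dvd_gcd h₁.two_dvd h₂.two_dvd) (by rw [hpq]; decide)
    · exact .inl ⟨h₁.add_odd h₂, (dvd_vietaFib_of_even x h₁).mul_right _⟩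
    · exact .inl ⟨h₁.add_even h₂, (dvd_vietaFib_of_even x h₂).mul_left _⟩
    · exact .inr ⟨h₁.add_odd h₂,
        (isCoprime_vietaFib_of_odd x h₁).mul_right (isCoprime_vietaFib_of_odd x h₂)⟩
  rcases hcases with ⟨h₁, e, he⟩ | ⟨h₁, c, d, hcd⟩
  · intro w
    obtain ⟨c, d, hcd⟩ := isCoprime_vietaFib_of_odd x h₁
    refine ⟨c • w + (d * e) • T w, ?_⟩
    calc _ = (c * x) • w + d • (x * e) • T w := by module
      _ = (c * x + d * vietaFib x (p + q)) • w := by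
        rw [← map_smul T, ← he, ← hT]; module
      _ = w := by rw [hcd, one_smul]
  · intro w'
    obtain ⟨w, rfl⟩ := hTs w'
    obtain ⟨e, he⟩ := dvd_vietaFib_of_even x h₁
    refine ⟨c • T w + (d * e) • w, ?_⟩
    calc _ = (c * x) • T w + d • (x * e) • w := by module
      _ = (c * x + d * (vietaFib x p * vietaFib x q)) • T w := by
        rw [← he, hT, map_smul]; module
      _ = T w := by rw [hcd, one_smul]

end Spanned

end RootedPair

/-! ### The adjacency operator of a rooted product with a path -/

section RootedProduct

open Matrix Polynomial
open scoped Kronecker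

theorem adjMatrix_rootedProduct {V U : Type*} [DecidableEq V] [DecidableEq U]
    (G : SimpleGraph V) (H : SimpleGraph U) (r : U) [DecidableRel G.Adj] [DecidableRel H.Adj] :
    (rootedProduct G H r).adjMatrix ℤ =
      (1 : Matrix V V ℤ) ⊗ₖ H.adjMatrix ℤ + G.adjMatrix ℤ ⊗ₖ Matrix.single r r 1 := by
  ext ⟨i, a⟩ ⟨j, b⟩
  have h : (rootedProduct G H r).Adj (i, a) (j, b) ↔
    (i = j ∧ H.Adj a b) ∨ (G.Adj i j ∧ a = r ∧ b = r) := Iff.rfl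
  simp only [SimpleGraph.adjMatrix_apply, h, Matrix.add_apply, kroneckerMap_apply,
    Matrix.one_apply, Matrix.single_apply]
  by_cases hij : i = j
  · subst hij
    simp
  · simp only [hij, false_and, false_or, if_false, zero_mul, zero_add, eq_comm (a := r)]
    by_cases h : G.Adj i j <;> simp [h]

/-- The pure tensor `u ⊗ w`. -/
def pureTensor {V U : Type*} (u : V → ℤ) (w : U → ℤ) : V × U → ℤ := fun y => u y.1 * w y.2

section PureTensor

variable {V U : Type*}

theorem pureTensor_add (u : V → ℤ) (w w' : U → ℤ) :
    pureTensor u (w + w') = pureTensor u w + pureTensor u w' :=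
  funext fun _ => mul_add _ _ _

theorem pureTensor_zero (u : V → ℤ) : pureTensor u (0 : U → ℤ) = 0 :=
  funext fun _ => mul_zero _

theorem pureTensor_sum {ι : Type*} (s : Finset ι) (u : V → ℤ) (w : ι → U → ℤ) :
    pureTensor u (∑ k ∈ s, w k) = ∑ k ∈ s, pureTensor u (w k) := by
  ext y
  simp [pureTensor, Finset.mul_sum]

theorem kronecker_mulVec_pureTensor [Fintype V] [Fintype U] (A : Matrix V V ℤ) (B : Matrix U U ℤ)
    (u : V → ℤ) (w : U → ℤ) :
    (A ⊗ₖ B) *ᵥ pureTensor u w = pureTensor (A *ᵥ u) (B *ᵥ w) := by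
  ext ⟨i, a⟩
  simp only [mulVec, dotProduct, pureTensor, kroneckerMap_apply, Fintype.sum_prod_type,
    Finset.sum_mul_sum]
  exact Finset.sum_congr rfl fun _ _ => Finset.sum_congr rfl fun _ _ => by ring

theorem eq_sum_pureTensor [Fintype U] [DecidableEq U] (w : V × U → ℤ) :
    w = ∑ k, pureTensor (fun v => w (v, k)) (Pi.single k 1) := by
  ext ⟨v, k⟩
  simp [pureTensor, Pi.single_apply]

end PureTensor

/-- The indicator of the vertex of `P_m` with number `j`, where the vertices are numbered
`1, …, m`; it is `0` for `j = 0` and for `j = m + 1`. -/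
def pathVec (m j : ℕ) : Fin m → ℤ := fun k => if (k : ℕ) + 1 = j then 1 else 0

theorem pathVec_zero (m : ℕ) : pathVec m 0 = 0 := rfl

theorem pathVec_succ_self (m : ℕ) : pathVec m (m + 1) = 0 :=
  funext fun k => if_neg (by omega)

theorem pathVec_val_add_one {m : ℕ} (k : Fin m) : pathVec m (k + 1) = Pi.single k 1 := by
  ext i
  simp [pathVec, Pi.single_apply, Fin.ext_iff]

theorem adjMatrix_mulVec_pathVec {m j : ℕ} (hj : j < m) :
    (SimpleGraph.pathGraph m).adjMatrix ℤ *ᵥ pathVec m (j + 1) =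
      pathVec m j + pathVec m (j + 2) := by
  have := pathVec_val_add_one ⟨j, hj⟩
  simp only at this
  rw [this, mulVec_single_one]
  ext k
  simp only [Matrix.col_apply, SimpleGraph.adjMatrix_apply, SimpleGraph.pathGraph_adj, pathVec,
    Pi.add_apply]
  split_ifs <;> omega

theorem single_mulVec_pathVec {m : ℕ} (r : Fin m) (j : ℕ) :
    (Matrix.single r r 1 : Matrix (Fin m) (Fin m) ℤ) *ᵥ pathVec m j =
      if j = r + 1 then pathVec m j else 0 := by
  ext k
  simp only [mulVec, dotProduct]
  rw [Finset.sum_eq_single r (fun i _ hi => by simp [hi.symm]) (by simp)]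
  rcases eq_or_ne k r with rfl | hk
  · rcases eq_or_ne j (k + 1) with rfl | h <;> simp [pathVec, *, Ne.symm]
  · have : ¬ (k : ℕ) = r := fun h => hk (Fin.ext h)
    split_ifs with h <;> simp [hk.symm, pathVec, h, this]

variable {V : Type*} [Fintype V] [DecidableEq V] {m : ℕ}

/-- The operator `1 ⊗ A(P_m) + A ⊗ E`, where `E` is the projection to the root `r` of the path
`P_m`: the adjacency operator of the rooted product if `A` is the adjacency matrix of a graph. -/
def rootedPathMatrix (A : Matrix V V ℤ) (r : Fin m) : Matrix (V × Fin m) (V × Fin m) ℤ :=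
  (1 : Matrix V V ℤ) ⊗ₖ (SimpleGraph.pathGraph m).adjMatrix ℤ + A ⊗ₖ Matrix.single r r 1

theorem rootedPathMatrix_mulVec (A : Matrix V V ℤ) (r : Fin m) (u : V → ℤ) {j : ℕ} (hj : j < m) :
    rootedPathMatrix A r *ᵥ pureTensor u (pathVec m (j + 1)) =
      pureTensor u (pathVec m j) + pureTensor u (pathVec m (j + 2)) +
        if j = r then pureTensor (A *ᵥ u) (pathVec m (j + 1)) else 0 := by
  rw [rootedPathMatrix, add_mulVec, kronecker_mulVec_pureTensor, kronecker_mulVec_pureTensor,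
    one_mulVec, adjMatrix_mulVec_pathVec hj, pureTensor_add, single_mulVec_pathVec]
  simp only [add_left_inj]
  split_ifs <;> simp [pureTensor_zero]

theorem commute_rootedPathMatrix (A : Matrix V V ℤ) (r : Fin m) :
    Commute (A ⊗ₖ (1 : Matrix (Fin m) (Fin m) ℤ)) (rootedPathMatrix A r) := by
  simp [Commute, SemiconjBy, rootedPathMatrix, mul_add, add_mul, ← mul_kronecker_mul]

section Module

variable (A : Matrix V V ℤ) (r : Fin m)

/-- `ℤ^(V × Fin m)` as a module over `ℤ[X]`, where `X` acts as the adjacency operator. -/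
abbrev RootedPathModule : Type _ := Module.AEval' (toLin' (rootedPathMatrix A r))

/-- The identification of the integer vectors with the elements of the module. -/
abbrev toModule : (V × Fin m → ℤ) ≃ₗ[ℤ] RootedPathModule A r :=
  Module.AEval'.of (toLin' (rootedPathMatrix A r))

/-- The operator `A ⊗ 1`, which is linear over `ℤ[X]` as it commutes with the adjacency
operator. -/
noncomputable def baseEnd : Module.End ℤ[X] (RootedPathModule A r) :=
  LinearMap.ofAEval _
    ((toModule A r).toLinearMap ∘ₗ toLin' (A ⊗ₖ (1 : Matrix (Fin m) (Fin m) ℤ))) (by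
      intro w
      rw [LinearMap.comp_apply, LinearMap.comp_apply, LinearEquiv.coe_coe]
      refine Eq.trans ?_ (Module.AEval'.X_smul_of _ _).symm
      simp only [Module.End.smul_def, toLin'_apply, mulVec_mulVec]
      rw [(commute_rootedPathMatrix A r).eq]
      rfl)

theorem X_smul_toModule (w : V × Fin m → ℤ) :
    (X : ℤ[X]) • toModule A r w = toModule A r (rootedPathMatrix A r *ᵥ w) :=
  Module.AEval'.X_smul_of _ _

theorem smul_toModule (f : ℤ[X]) (w : V × Fin m → ℤ) :
    f • toModule A r w = toModule A r (aeval (rootedPathMatrix A r) f *ᵥ w) := by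
  change _ = toModule A r (toLin' _ w)
  have : toLin' (aeval (rootedPathMatrix A r) f) = aeval (toLin' (rootedPathMatrix A r)) f :=
    (aeval_algHom_apply (toLinAlgEquiv' (R := ℤ) (n := V × Fin m)) _ _).symm
  rw [this]
  rfl

theorem baseEnd_toModule (w : V × Fin m → ℤ) :
    baseEnd A r (toModule A r w) =
      toModule A r ((A ⊗ₖ (1 : Matrix (Fin m) (Fin m) ℤ)) *ᵥ w) :=
  rfl

theorem baseEnd_pureTensor (u : V → ℤ) (w : Fin m → ℤ) :
    baseEnd A r (toModule A r (pureTensor u w)) = toModule A r (pureTensor (A *ᵥ u) w) := by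
  rw [baseEnd_toModule, kronecker_mulVec_pureTensor, one_mulVec]

theorem surjective_baseEnd (hA : IsUnit A.det) : Function.Surjective (baseEnd A r) := by
  have h : IsUnit (A ⊗ₖ (1 : Matrix (Fin m) (Fin m) ℤ)) := by
    rw [isUnit_iff_isUnit_det, det_kronecker, det_one, one_pow, mul_one]
    exact hA.pow _
  intro w
  obtain ⟨w, rfl⟩ := (toModule A r).surjective w
  obtain ⟨v, rfl⟩ := mulVec_surjective_iff_isUnit.mpr h w
  exact ⟨toModule A r v, baseEnd_toModule A r v⟩

/-- The vector `u`, placed at the `j`-th vertex of the path. -/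
noncomputable abbrev placed (u : V → ℤ) (j : ℕ) : RootedPathModule A r :=
  toModule A r (pureTensor u (pathVec m j))

theorem X_smul_placed (u : V → ℤ) {j : ℕ} (hj : j < m) :
    (X : ℤ[X]) • placed A r u (j + 1) = placed A r u j + placed A r u (j + 2) +
      if j = r then baseEnd A r (placed A r u (j + 1)) else 0 := by
  rw [baseEnd_pureTensor, X_smul_toModule, rootedPathMatrix_mulVec A r u hj, map_add, map_add]
  split_ifs <;> simp

/-- Walking along the path from its first vertex to the root. -/
theorem placed_left (u : V → ℤ) {j : ℕ} (hj : j ≤ r + 1) :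
    placed A r u j = vietaFib (X : ℤ[X]) j • placed A r u 1 := by
  refine eq_vietaFib_smul (n := r + 1) (f := placed A r u) ?_ (fun j hj => ?_) j hj
  · simp [placed, pathVec_zero, pureTensor_zero]
  · rw [X_smul_placed A r u (by omega), if_neg (by omega), add_zero]

/-- Walking along the path from its last vertex to the root. -/
theorem placed_right (u : V → ℤ) {j : ℕ} (hj : j ≤ m - r) :
    placed A r u (m + 1 - j) = vietaFib (X : ℤ[X]) j • placed A r u m := by
  refine eq_vietaFib_smul (n := m - r) (f := fun j => placed A r u (m + 1 - j)) ?_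
    (fun j hj => ?_) j hj
  · simp [placed, pathVec_succ_self, pureTensor_zero]
  · obtain ⟨i, hi⟩ : ∃ i, m = i + j + 1 := ⟨m - (j + 1), by omega⟩
    simp only [show m + 1 - (j + 1) = i + 1 by omega, show m + 1 - j = i + 2 by omega,
      show m + 1 - (j + 2) = i by omega]
    rw [X_smul_placed A r u (by omega), if_neg (by omega), add_zero, add_comm]

theorem isRootedPair_placed (u : V → ℤ) :
    IsRootedPair (X : ℤ[X]) (baseEnd A r) (r + 1) (m - r) (placed A r u 1) (placed A r u m) where
  root_eq := by
    rw [← placed_left A r u le_rfl, ← placed_right A r u le_rfl]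
    congr 1
    omega
  smul_root := by
    rw [← placed_left A r u le_rfl, X_smul_placed A r u r.2, if_pos rfl,
      ← placed_left A r u (by omega), ← placed_right A r u (by omega),
      show m + 1 - (m - r - 1) = r + 2 by omega]
    rfl

/-- Every vertex of the path is generated by one of the two end points. -/
theorem mem_span_placed (u : V → ℤ) (k : Fin m) :
    toModule A r (pureTensor u (Pi.single k 1)) ∈
      Submodule.span ℤ[X] {placed A r u 1, placed A r u m} := by
  rw [← pathVec_val_add_one]
  change placed A r u (k + 1) ∈ _
  rcases le_total (k + 1 : ℕ) (r + 1) with h | h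
  · rw [placed_left A r u h]
    exact Submodule.smul_mem _ _ (Submodule.subset_span (by simp))
  · have := placed_right A r u (j := m + 1 - (k + 1)) (by omega)
    rw [show m + 1 - (m + 1 - (k + 1)) = (k + 1 : ℕ) by omega] at this
    rw [this]
    exact Submodule.smul_mem _ _ (Submodule.subset_span (by simp))

theorem vietaFib_add_smul_rootedPathModule (w : RootedPathModule A r) :
    vietaFib (X : ℤ[X]) (r + 1 + (m - r)) • w =
      baseEnd A r ((vietaFib (X : ℤ[X]) (r + 1) * vietaFib X (m - r)) • w) := by
  refine vietaFib_add_smul (by omega) (by omega) (eq_top_iff.mpr fun w _ => ?_) w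
  obtain ⟨w, rfl⟩ := (toModule A r).surjective w
  rw [eq_sum_pureTensor w, map_sum]
  refine Submodule.sum_mem _ fun k _ => Submodule.span_mono ?_ (mem_span_placed A r _ k)
  rintro _ (rfl | rfl)
  · exact ⟨_, .inl (isRootedPair_placed A r _)⟩
  · exact ⟨_, .inr (isRootedPair_placed A r _)⟩

/-- The sum of all vertices of the path, split after the root. -/
theorem pureTensor_one_eq (u : V → ℤ) :
    toModule A r (pureTensor u 1) =
      (∑ j ∈ Finset.range (r + 1 + 1), vietaFib (X : ℤ[X]) j) • placed A r u 1 +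
        (∑ j ∈ Finset.range (m - r), vietaFib (X : ℤ[X]) j) • placed A r u m := by
  have h₁ : (1 : Fin m → ℤ) = ∑ j ∈ Finset.range (r + 2 + (m - r - 1)), pathVec m j := by
    rw [show (r + 2 + (m - r - 1) : ℕ) = m + 1 by omega, Finset.sum_range_succ', pathVec_zero,
      add_zero, ← Fin.sum_univ_eq_sum_range (fun j => pathVec m (j + 1))]
    ext k
    simp [pathVec_val_add_one, Pi.single_apply]
  obtain ⟨n, hn⟩ : ∃ n, m - r = n + 1 := ⟨m - r - 1, by omega⟩
  rw [h₁, pureTensor_sum, map_sum, Finset.sum_range_add, Finset.sum_smul, Finset.sum_smul, hn,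
    Nat.add_sub_cancel, Finset.sum_range_succ' _ n, ← Finset.sum_range_reflect _ n]
  simp only [vietaFib_zero, zero_smul, add_zero]
  congr 1
  · exact Finset.sum_congr rfl fun j hj => placed_left A r u (by simp at hj; omega)
  · refine Finset.sum_congr rfl fun j hj => ?_
    simp only [Finset.mem_range] at hj
    rw [← placed_right A r u (by omega)]
    congr 3
    omega

variable {r} (hr : Nat.Coprime (r + 1) (m - r)) (hA : IsUnit A.det)

include hr hA

/-- `X` acts surjectively on the module, that is, the matrix is invertible over `ℤ`. -/
theorem isUnit_det_rootedPathMatrix : IsUnit (rootedPathMatrix A r).det := by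
  rw [← isUnit_iff_isUnit_det, ← mulVec_surjective_iff_isUnit]
  intro w
  obtain ⟨v, hv⟩ := surjective_smul_self hr (vietaFib_add_smul_rootedPathModule A r)
    (surjective_baseEnd A r hA) (toModule A r w)
  obtain ⟨v, rfl⟩ := (toModule A r).surjective v
  refine ⟨v, (toModule A r).injective ?_⟩
  rw [← X_smul_toModule]
  exact hv

/-- The cyclic `ℤ[X]`-module generated by `u ⊗ 1` contains the end points of the path that carry
`u`, hence all its vertices, and it is stable under `A ⊗ 1`. -/
theorem exists_aeval_mulVec_eq (u : V → ℤ) (i : ℕ) (k : Fin m) :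
    ∃ f : ℤ[X], aeval (rootedPathMatrix A r) f *ᵥ pureTensor u 1 =
      pureTensor ((A ^ i) *ᵥ u) (Pi.single k 1) := by
  suffices h : toModule A r (pureTensor ((A ^ i) *ᵥ u) (Pi.single k 1)) ∈
      Submodule.span ℤ[X] {toModule A r (pureTensor u 1)} by
    obtain ⟨f, hf⟩ := Submodule.mem_span_singleton.mp h
    exact ⟨f, (toModule A r).injective (by rw [← smul_toModule, hf])⟩
  have hT := vietaFib_add_smul_rootedPathModule A r
  induction i with
  | zero =>
    have := (isRootedPair_placed A r u).mem_of_sum_mem hr hT (surjective_baseEnd A r hA)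
      (L := Submodule.span ℤ[X] {toModule A r (pureTensor u 1)}) (by
        rw [← pureTensor_one_eq]
        exact Submodule.mem_span_singleton_self _)
    rw [pow_zero, one_mulVec]
    refine (Submodule.span_le.mpr ?_) (mem_span_placed A r u k)
    rintro _ (rfl | rfl)
    exacts [this.1, this.2]
  | succ i ih =>
    rw [pow_succ', ← mulVec_mulVec, ← baseEnd_pureTensor]
    exact apply_mem_of_mem hr hT ih

end Module

end RootedProduct

/-! ### Column spans of walk matrices -/

section Walk

open Matrix Polynomial
open scoped Kronecker

/-- If the columns of `L` are integer combinations of those of `K`, then `L = K * U` with an integer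
matrix `U`. -/
theorem det_submatrix_dvd {I J J' N : Type*} [Fintype J] [Fintype N] [DecidableEq N]
    (K : Matrix I J ℤ) (L : Matrix I J' ℤ) (σ : N ≃ I) (ρ : N ≃ J) (ρ' : N ≃ J')
    (h : ∀ j, ∃ c, K *ᵥ c = fun i => L i j) :
    (K.submatrix σ ρ).det ∣ (L.submatrix σ ρ').det := by
  choose c hc using h
  have : L.submatrix σ ρ' = K.submatrix σ ρ * (Matrix.of fun j k => c (ρ' k) (ρ j)) := by
    ext i k
    rw [submatrix_apply, ← congrFun (hc (ρ' k)) (σ i), mul_apply, mulVec, dotProduct,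
      ← ρ.sum_comp]
    rfl
  rw [this, det_mul]
  exact dvd_mul_right _ _

variable {V : Type*} [Fintype V] [DecidableEq V] (G : SimpleGraph V) [DecidableRel G.Adj]

/-- By Cayley–Hamilton, the columns of the walk matrix span the cyclic module generated by the
all-ones vector. -/
theorem exists_walkMatrix_mulVec_eq_iff (w : V → ℤ) :
    (∃ c, walkMatrix G *ᵥ c = w) ↔ ∃ f : ℤ[X], aeval (G.adjMatrix ℤ) f *ᵥ 1 = w := by
  have key (c : Fin (Fintype.card V) → ℤ) :
      walkMatrix G *ᵥ c = ∑ k, c k • (G.adjMatrix ℤ ^ (k : ℕ) *ᵥ 1) := by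
    ext v
    simp only [mulVec, dotProduct, walkMatrix, of_apply, Finset.sum_apply, Pi.smul_apply,
      smul_eq_mul, mul_comm (c _)]
    rfl
  constructor
  · rintro ⟨c, rfl⟩
    refine ⟨∑ k, C (c k) * X ^ (k : ℕ), ?_⟩
    rw [key, map_sum, sum_mulVec]
    exact Finset.sum_congr rfl fun k _ => by
      rw [← smul_eq_C_mul, map_smul, map_pow, aeval_X, smul_mulVec]
  · rintro ⟨f, rfl⟩
    set g := f %ₘ (G.adjMatrix ℤ).charpoly
    refine ⟨fun k => g.coeff k, ?_⟩
    have hg : g.degree < Fintype.card V := by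
      rw [← charpoly_degree_eq_dim (G.adjMatrix ℤ)]
      exact degree_modByMonic_lt _ (charpoly_monic _)
    rw [key, aeval_eq_aeval_mod_charpoly, aeval_def, eval₂_eq_sum,
      ← sum_fin (fun k c => algebraMap ℤ _ c * G.adjMatrix ℤ ^ k) (by simp) hg, sum_mulVec]
    exact Finset.sum_congr rfl fun k _ => by rw [← Algebra.smul_def, smul_mulVec]

theorem walkMatrix_kronecker_one_mulVec {m : ℕ} (c : Fin (Fintype.card V) × Fin m → ℤ) (v : V)
    (k : Fin m) :
    ((walkMatrix G ⊗ₖ (1 : Matrix (Fin m) (Fin m) ℤ)) *ᵥ c) (v, k) =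
      (walkMatrix G *ᵥ fun i => c (i, k)) v := by
  simp [mulVec, dotProduct, Fintype.sum_prod_type, kroneckerMap_apply, Matrix.one_apply]

/-- The columns of `W(G ∘ P_m)` are integer combinations of those of `W(G) ⊗ 1`, as the vectors
whose restrictions to all layers `V × {k}` lie in the cyclic module generated by the all-ones vector
of `G` are preserved by the adjacency operator. -/
theorem exists_walkMatrix_kronecker_mulVec_eq {m : ℕ} (r : Fin m) (n : ℕ) :
    ∃ c, (walkMatrix G ⊗ₖ (1 : Matrix (Fin m) (Fin m) ℤ)) *ᵥ c =
      rootedPathMatrix (G.adjMatrix ℤ) r ^ n *ᵥ 1 := by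
  suffices h : ∃ f : Fin m → ℤ[X], rootedPathMatrix (G.adjMatrix ℤ) r ^ n *ᵥ 1 =
      ∑ k, pureTensor (aeval (G.adjMatrix ℤ) (f k) *ᵥ 1) (Pi.single k 1) by
    obtain ⟨f, hf⟩ := h
    choose c hc using fun k => (exists_walkMatrix_mulVec_eq_iff G _).mpr ⟨f k, rfl⟩
    refine ⟨fun y => c y.2 y.1, ?_⟩
    rw [hf]
    ext ⟨v, k⟩
    rw [walkMatrix_kronecker_one_mulVec, hc]
    simp [pureTensor, Pi.single_apply]
  induction n with
  | zero =>
    refine ⟨1, ?_⟩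
    ext ⟨v, k⟩
    simp [pureTensor, Pi.single_apply]
  | succ n ih =>
    obtain ⟨f, hf⟩ := ih
    refine ⟨fun k => ∑ j, C ((SimpleGraph.pathGraph m).adjMatrix ℤ k j) * f j +
      X * ∑ j, C (Matrix.single r r (1 : ℤ) k j) * f j, ?_⟩
    rw [pow_succ', ← mulVec_mulVec, hf, rootedPathMatrix, mulVec_sum]
    simp only [add_mulVec, kronecker_mulVec_pureTensor, mulVec_mulVec, one_mul]
    ext ⟨v, k⟩
    simp only [Finset.sum_apply, Pi.add_apply, pureTensor, mulVec_single_one, Matrix.col_apply,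
      Pi.single_apply, mul_ite, mul_one, mul_zero, Finset.sum_ite_eq, Finset.mem_univ, if_true,
      map_add, map_sum, map_mul, aeval_X, aeval_C, add_mulVec, sum_mulVec, Finset.mul_sum,
      Finset.sum_add_distrib]
    congr 1 <;> refine Finset.sum_congr rfl fun j _ => ?_
    · rw [← Algebra.smul_def, smul_mulVec, Pi.smul_apply, smul_eq_mul, mul_comm]
    · rw [← Algebra.smul_def, mul_smul_comm, smul_mulVec, Pi.smul_apply, smul_eq_mul, mul_comm]

/-- Up to sign, `det W(G ∘ P_m) = det W(G) ^ m`: the columns of `W(G ∘ P_m)` and those of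
`W(G) ⊗ 1` span the same subgroup, so that the two matrices divide each other. -/
theorem associated_det_walkMatrix_rootedProduct {m : ℕ} (r : Fin m) (hr : Nat.Coprime (r + 1) (m - r))
    (hA : IsUnit (G.adjMatrix ℤ).det) (τ : Fin (Fintype.card V) ≃ V)
    (σ : Fin (Fintype.card (V × Fin m)) ≃ V × Fin m) :
    Associated (((walkMatrix (rootedProduct G (SimpleGraph.pathGraph m) r)).submatrix σ id).det)
      (((walkMatrix G).submatrix τ id).det ^ m) := by
  set K := walkMatrix G ⊗ₖ (1 : Matrix (Fin m) (Fin m) ℤ)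
  -- A numbering of the columns for which `K` becomes a conjugate of a square Kronecker product.
  set ρ : Fin (Fintype.card (V × Fin m)) ≃ Fin (Fintype.card V) × Fin m :=
    σ.trans (τ.symm.prodCongr (Equiv.refl _))
  have hK : (K.submatrix σ ρ).det = ((walkMatrix G).submatrix τ id).det ^ m := by
    have h₁ : K.submatrix σ ρ =
        ((walkMatrix G).submatrix id τ.symm ⊗ₖ (1 : Matrix (Fin m) (Fin m) ℤ)).submatrix σ σ := rfl
    have h₂ : (walkMatrix G).submatrix τ id =
        ((walkMatrix G).submatrix id τ.symm).submatrix τ τ := by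
      ext
      simp
    rw [h₁, det_submatrix_equiv_self, det_kronecker, h₂, det_submatrix_equiv_self]
    simp
  have hA' : (rootedProduct G (SimpleGraph.pathGraph m) r).adjMatrix ℤ =
    rootedPathMatrix (G.adjMatrix ℤ) r := adjMatrix_rootedProduct _ _ _
  rw [← hK]
  refine associated_of_dvd_dvd (det_submatrix_dvd _ _ σ (Equiv.refl _) ρ ?_)
    (det_submatrix_dvd _ _ σ ρ (Equiv.refl _) ?_)
  · rintro ⟨i, k⟩
    rw [exists_walkMatrix_mulVec_eq_iff, hA']
    obtain ⟨f, hf⟩ := exists_aeval_mulVec_eq (G.adjMatrix ℤ) hr hA 1 i k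
    refine ⟨f, ?_⟩
    have h1 : pureTensor (1 : V → ℤ) (1 : Fin m → ℤ) = 1 := funext fun _ => mul_one _
    rw [← h1, hf]
    ext ⟨v, j⟩
    simp [K, pureTensor, kroneckerMap_apply, Matrix.one_apply, Pi.single_apply, walkMatrix]
    rfl
  · intro n
    obtain ⟨c, hc⟩ := exists_walkMatrix_kronecker_mulVec_eq G r n
    exact ⟨c, by rw [hc, ← hA']; rfl⟩

end Walk

/-! ### The family `𝓕` is preserved -/

theorem proposition5p2 {V : Type*} [Fintype V] [DecidableEq V] (G : SimpleGraph V)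
    [DecidableRel G.Adj] (hG : MemFamily G) (m ℓ : ℕ) (h₁ : 1 ≤ ℓ) (h₂ : ℓ ≤ m)
    (hgcd : Nat.gcd ℓ (m + 1) = 1) :
    MemFamily (rootedProductPath G m ℓ h₁ h₂) := by
  obtain ⟨n, ⟨k, rfl⟩, hcard, hdet, hW⟩ := hG
  have hA : IsUnit (G.adjMatrix ℤ).det := Int.isUnit_iff.mpr hdet
  have hr : Nat.Coprime (ℓ - 1 + 1) (m - (ℓ - 1)) := by
    rw [Nat.sub_add_cancel h₁, show m - (ℓ - 1) = m + 1 - ℓ by omega]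
    exact (Nat.coprime_sub_self_right (by omega)).mpr hgcd
  refine ⟨(k + k) * m, (Even.add_self k).mul_right m, by simp [hcard], ?_, fun σ => ?_⟩
  · rw [← Int.isUnit_iff, adjMatrix_rootedProduct]
    exact isUnit_det_rootedPathMatrix _ hr hA
  · have τ := (Fintype.equivFin V).symm
    have h := associated_det_walkMatrix_rootedProduct G ⟨ℓ - 1, by omega⟩ hr hA τ σ
    have hexp : (k + k) * m / 2 = k * m := by
      rw [← two_mul, mul_assoc, Nat.mul_div_cancel_left _ two_pos]
    rw [hexp, pow_mul, ← Int.associated_iff]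
    refine h.trans (Associated.pow_pow ?_)
    rw [Int.associated_iff]
    have := hW τ
    rwa [← two_mul, Nat.mul_div_cancel_left _ two_pos] at this
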